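/- Let $k$ be a field and let $\mathcal O$ be a totally rational ring: a local $k$-subalgebra of finite codimension of $\widetilde{\mathcal O}=k[\![t_1]\!]\times\cdots\times k[\![t_d]\!]$ (for example, the completed local ring of an algebraic curve over $k$ at a point all of whose preimages in the normalization are $k$-rational). For $\underline n\in\mathbb N^d$ put $\|\underline n\|=n_1+\cdots+n_d$ and $\underline t^{\underline n}=(t_1^{n_1},\ldots,t_d^{n_d})$. Let $S\subseteq\mathbb N^d$ be the semigroup of values $\underline v(\underline z)=(\operatorname{ord}_{t_1}z_1,\ldots,\operatorname{ord}_{t_d}z_d)$ of the non-zero-divisors $\underline z\in\mathcal O$, and let $\underline c$ be its conductor, i.e. the least element (for the product order) with $\underline c+\mathbb N^d\subseteq S$. Let $\mathcal M_k=K_0(\mathrm{Var}_k)[\mathbb L^{-1}]$ be the Grothendieck ring of varieties over $k$ localized at $\mathbb L=[\mathbb A^1_k]$. Let $\mathcal J=\widetilde{\mathcal O}^{\times}/\mathcal O^{\times}$, regarded as an algebraic group over $k$, and for $\underline n\in S$ let $\mathcal I_{\underline n}$ be the set of principal ideals $\underline z\mathcal O\subseteq\mathcal O$ with $\underline v(\underline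 z)=\underline n$, regarded as the closed subvariety $\{[\underline\mu]\in\mathcal J \mid \underline t^{\underline n}\underline\mu\in\mathcal O\}$ of $\mathcal J$. Put $$Z(T_1,\ldots,T_d,\mathcal O)=\sum_{\underline n\in S}[\mathcal I_{\underline n}]\,\mathbb L^{-\|\underline n\|}\,T_1^{n_1}\cdots T_d^{n_d}\in\mathcal M_k[\![T_1,\ldots,T_d]\!],\qquad Z(T,\mathcal O)=Z(T,\ldots,T,\mathcal O).$$ Then $Z(T,\mathcal O)$ is a rational function of the form $$Z(T,\mathcal O)=\frac{R(T,\mathcal O)}{(1-\mathbb L^{-1}T)^d},$$ where $R(T,\mathcal O)\in\mathcal M_k[T]$ is a polynomial of degree at most $\|\underline c\|$ with $R(\mathbb L,\mathcal O)=[\mathcal J]$. -/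

import Mathlib

universe u
namespace CurveZeta
open CategoryTheory AlgebraicGeometry
open scoped TensorProduct

/-! ### The Grothendieck ring of varieties and its localization -/

/-- An algebraic variety over `k`: a separated scheme of finite type over `k`. (Reducedness is not
imposed; it does not change the Grothendieck ring, since `[X] = [X_red]` by the scissor relation,
and it is not stable under products over an imperfect field.) -/
structure Variety (k : Type u) [Field k] where
  toScheme : Scheme.{u}
  str : toScheme ⟶ Spec (CommRingCat.of k)
  locallyOfFiniteType : LocallyOfFiniteType str
  quasiCompact : QuasiCompact str
  isSeparated : IsSeparated str

/-- The affine variety `Spec R` of a `k`-algebra `R` of finite type. -/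
noncomputable def specVariety (k : Type u) [Field k] (R : Type u) [CommRing R] [Algebra k R]
    [h : Algebra.FiniteType k R] : Variety k where
  toScheme := Spec (CommRingCat.of R)
  str := Spec.map (CommRingCat.ofHom (algebraMap k R))
  locallyOfFiniteType := by
    rw [HasRingHomProperty.Spec_iff (P := @LocallyOfFiniteType)]
    exact RingHom.finiteType_algebraMap.mpr h
  quasiCompact := inferInstance
  isSeparated := inferInstance

/-- The defining relations of `K₀(Var_k)`: `[X] = [Y]` for isomorphic `X`, `Y`;
`[X] = [X \ Z] + [Z]` for `Z` closed in `X`; `[X × Y] = [X] [Y]`; and `[point] = 1`. -/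
inductive K0Rel (k : Type u) [Field k] :
    FreeCommRing (Variety k) → FreeCommRing (Variety k) → Prop
  | iso (X Y : Variety k) (e : X.toScheme ≅ Y.toScheme) (h : e.hom ≫ Y.str = X.str) :
      K0Rel k (FreeCommRing.of X) (FreeCommRing.of Y)
  | scissor (X Z U : Variety k) (i : Z.toScheme ⟶ X.toScheme) (j : U.toScheme ⟶ X.toScheme)
      (hi : IsClosedImmersion i) (hj : IsOpenImmersion j)
      (hiX : i ≫ X.str = Z.str) (hjX : j ≫ X.str = U.str)
      (hcompl : Set.range j = (Set.range i)ᶜ) :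
      K0Rel k (FreeCommRing.of X) (FreeCommRing.of U + FreeCommRing.of Z)
  | prod (X Y P : Variety k) (p : P.toScheme ⟶ X.toScheme) (q : P.toScheme ⟶ Y.toScheme)
      (hP : IsPullback p q X.str Y.str) (hpX : p ≫ X.str = P.str) :
      K0Rel k (FreeCommRing.of P) (FreeCommRing.of X * FreeCommRing.of Y)
  | point : K0Rel k (FreeCommRing.of (specVariety k k)) 1

/-- The Grothendieck ring `K₀(Var_k)`: the commutative ring generated by the varieties over `k`,
subject to the relations above. -/
abbrev K0 (k : Type u) [Field k] : Type (u + 1) :=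
  FreeCommRing (Variety k) ⧸ Ideal.ofRel (K0Rel k)

/-- The class `[X]` in `K₀(Var_k)`. -/
noncomputable def K0.mk {k : Type u} [Field k] (X : Variety k) : K0 k :=
  Ideal.Quotient.mk _ (FreeCommRing.of X)

/-- The class `𝕃 = [𝔸¹]` in `K₀(Var_k)`. -/
noncomputable def K0.lefschetz (k : Type u) [Field k] : K0 k := K0.mk (specVariety k (Polynomial k))

/-- `𝓜_k = K₀(Var_k)[𝕃⁻¹]`. -/
abbrev MotivicRing (k : Type u) [Field k] : Type (u + 1) := Localization.Away (K0.lefschetz k)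


/-- The class `[X]` in `𝓜_k`. -/
noncomputable def MotivicRing.mk {k : Type u} [Field k] (X : Variety k) : MotivicRing k :=
  algebraMap (K0 k) (MotivicRing k) (K0.mk X)

/-- `𝕃 = [𝔸¹]` in `𝓜_k`. -/
noncomputable def MotivicRing.lefschetz (k : Type u) [Field k] : MotivicRing k :=
  MotivicRing.mk (specVariety k (Polynomial k))

/-- `𝕃⁻¹` in `𝓜_k`. -/
noncomputable def MotivicRing.lefschetzInv (k : Type u) [Field k] : MotivicRing k :=
  IsLocalization.Away.invSelf (K0.lefschetz k)

/-! ### The quotient of the unit group of `E` by the unit group of a subalgebra `B`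

For a commutative `k`-algebra `E` and a subalgebra `B`, the varieties of interest parametrize the
cosets in `(A ⊗ E)ˣ ⧸ (A ⊗ B)ˣ`, where `A` runs through all commutative `k`-algebras. -/

section Universal
variable {k : Type u} [Field k] {E : Type u} [CommRing E] [Algebra k E]

/-- The subgroup `(A ⊗ B)ˣ` of `(A ⊗ E)ˣ`. -/
def unitSubgroup (B : Subalgebra k E) (A : Type u) [CommRing A] [Algebra k A] :
    Subgroup (A ⊗[k] E)ˣ :=
  (B.baseChange A).toSubmonoid.units

/-- The map `(R ⊗ E)ˣ → (A ⊗ E)ˣ` induced by `f : R → A`. -/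
noncomputable def unitMap (E : Type u) [CommRing E] [Algebra k E] {R A : Type u} [CommRing R]
    [Algebra k R] [CommRing A] [Algebra k A] (f : R →ₐ[k] A) : (R ⊗[k] E)ˣ →* (A ⊗[k] E)ˣ :=
  Units.map (Algebra.TensorProduct.map f (AlgHom.id k E)).toRingHom.toMonoidHom

/-- An affine variety `Spec R` of finite type over `k` representing the functor
`A ↦ (A ⊗ E)ˣ ⧸ (A ⊗ B)ˣ` on commutative `k`-algebras, given by its coordinate ring `R` and a
representative `μ` of the universal coset: for every `A`, each coset is the image of `[μ]` under
exactly one `k`-algebra homomorphism `R → A`. It is unique up to unique isomorphism. -/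
structure CosetModel (B : Subalgebra k E) where
  coordRing : Type u
  [commRing : CommRing coordRing]
  [algebra : Algebra k coordRing]
  [finiteType : Algebra.FiniteType k coordRing]
  point : (coordRing ⊗[k] E)ˣ
  universal : ∀ (A : Type u) [CommRing A] [Algebra k A] (x : (A ⊗[k] E)ˣ),
    ∃! f : coordRing →ₐ[k] A,
      (unitMap E f point : (A ⊗[k] E)ˣ ⧸ unitSubgroup B A) = x

attribute [instance] CosetModel.commRing CosetModel.algebra CosetModel.finiteType

/-- The power `N ^ j` as a `k`-subspace of `E`. -/
def powSub (N : Ideal E) (j : ℕ) : Submodule k E := (N ^ j).restrictScalars k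

/-! The next lemmas prove the existence of a `CosetModel` through a normal form for the cosets. -/

lemma exists_adapted (B : Submodule k E) (N : Ideal E) (r : ℕ) (hr : N ^ r = ⊥) (s : ℕ) :
    ∀ j, r ≤ j + s → ∃ C : Submodule k E, C ≤ powSub N j ∧ Disjoint C B ∧
      ∀ i, j ≤ i → (powSub N i : Submodule k E) ≤ (B ⊓ powSub N i) ⊔ C := by
  induction s with
  | zero =>
    intro j hj
    refine ⟨⊥, bot_le, disjoint_bot_left, fun i hi x hx => ?_⟩
    have : x ∈ N ^ r := Ideal.pow_le_pow_right (by omega) (show x ∈ N ^ i from hx)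
    rw [hr] at this
    rw [Ideal.mem_bot.1 this]
    exact zero_mem _
  | succ s ih =>
    intro j hj
    obtain ⟨C, hC1, hC2, hC3⟩ := ih (j + 1) (by omega)
    have hle : (powSub N (j + 1) : Submodule k E) ≤ powSub N j :=
      fun x hx => Ideal.pow_le_pow_right (Nat.le_succ j) (show x ∈ N ^ (j + 1) from hx)
    set W : Submodule k E := (B ⊓ powSub N j) ⊔ powSub N (j + 1) with hW
    have hWle : W ≤ powSub N j := sup_le inf_le_right hle
    obtain ⟨Q, hQ⟩ := Submodule.exists_isCompl W
    have hD : W ⊔ (Q ⊓ powSub N j) = powSub N j := by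
      rw [← sup_inf_assoc_of_le _ hWle, hQ.sup_eq_top, top_inf_eq]
    refine ⟨C ⊔ (Q ⊓ powSub N j), sup_le (hC1.trans hle) inf_le_right, ?_, ?_⟩
    · rw [Submodule.disjoint_def]
      intro x hx hxB
      obtain ⟨c, hc, e, he, rfl⟩ := Submodule.mem_sup.1 hx
      have h1 : c + e ∈ W := Submodule.mem_sup_left
        ⟨hxB, add_mem (hle (hC1 hc)) he.2⟩
      have h2 : e ∈ W := by
        have h3 : c ∈ W := Submodule.mem_sup_right (hC1 hc)
        simpa using sub_mem h1 h3
      have h0 : e = 0 := Submodule.disjoint_def.1 hQ.disjoint e h2 he.1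
      subst h0
      rw [add_zero] at hxB ⊢
      exact Submodule.disjoint_def.1 hC2 c hc hxB
    · intro i hi
      rcases Nat.eq_or_lt_of_le hi with rfl | hlt
      · conv_lhs => rw [← hD]
        refine sup_le (sup_le le_sup_left ?_) (le_sup_right.trans le_sup_right)
        refine (hC3 (j + 1) le_rfl).trans (sup_le_sup (inf_le_inf_left _ hle) le_sup_left)
      · exact (hC3 i hlt).trans (sup_le_sup le_rfl le_sup_left)

variable {A : Type u} [CommRing A] [Algebra k A]

lemma baseChange_ind {M : Submodule k E} {P : A ⊗[k] E → Prop} (h0 : P 0)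
    (ha : ∀ x y, P x → P y → P (x + y)) (ht : ∀ (a : A) (m : E), m ∈ M → P (a ⊗ₜ m))
    (x : A ⊗[k] E) (hx : x ∈ M.baseChange A) : P x := by
  obtain ⟨w, rfl⟩ := hx
  induction w with
  | zero => simpa using h0
  | tmul a m => exact ht a m m.2
  | add x y hx hy => rw [map_add]; exact ha _ _ hx hy

lemma bcMono {P Q : Submodule k E} (h : P ≤ Q) {x : A ⊗[k] E} (hx : x ∈ P.baseChange A) :
    x ∈ Q.baseChange A :=
  Submodule.baseChange_mono A h hx

lemma baseChange_mul {P Q S : Submodule k E} (h : ∀ x ∈ P, ∀ y ∈ Q, x * y ∈ S)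
    {x y : A ⊗[k] E} (hx : x ∈ P.baseChange A) (hy : y ∈ Q.baseChange A) :
    x * y ∈ S.baseChange A := by
  refine baseChange_ind (P := fun x => x * y ∈ S.baseChange A) (by simp) ?_ ?_ x hx
  · intro a b ha hb
    rw [add_mul]; exact add_mem ha hb
  intro a m hm
  refine baseChange_ind (P := fun y => (a ⊗ₜ[k] m) * y ∈ S.baseChange A) (by simp) ?_ ?_ y hy
  · intro a b ha hb
    rw [mul_add]; exact add_mem ha hb
  intro b n hn
  rw [Algebra.TensorProduct.tmul_mul_tmul]
  exact Submodule.tmul_mem_baseChange_of_mem _ (h m hm n hn)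

lemma powSub_mul {N : Ideal E} {i j : ℕ} {x y : E} (hx : x ∈ (powSub N i : Submodule k E))
    (hy : y ∈ (powSub N j : Submodule k E)) : x * y ∈ (powSub N (i + j) : Submodule k E) := by
  change x * y ∈ N ^ (i + j)
  rw [pow_add]
  exact Ideal.mul_mem_mul hx hy

lemma factor_exists (B : Subalgebra k E) (N : Ideal E) (r : ℕ) (hr : N ^ r = ⊥)
    (C : Submodule k E) (hC1 : C ≤ powSub N 1)
    (hC3 : ∀ i, 1 ≤ i → (powSub N i : Submodule k E) ≤ (B.toSubmodule ⊓ powSub N i) ⊔ C)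
    (s : ℕ) : ∀ j, r ≤ j + s → 1 ≤ j → ∀ c ∈ C.baseChange A,
      ∀ e ∈ (powSub N j : Submodule k E).baseChange A,
      ∃ b ∈ (B.toSubmodule ⊓ powSub N 1).baseChange A, ∃ c' ∈ C.baseChange A,
        (1 + c + e) * (1 + b) = 1 + c' := by
  induction s with
  | zero =>
    intro j hj _ c hc e he
    have h0 : (powSub N j : Submodule k E) = ⊥ := by
      rw [eq_bot_iff]
      intro x hx
      have : x ∈ N ^ r := Ideal.pow_le_pow_right (by omega) (show x ∈ N ^ j from hx)
      rw [hr] at this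
      exact this
    rw [h0, Submodule.baseChange_bot, Submodule.mem_bot] at he
    subst he
    exact ⟨0, zero_mem _, c, hc, by simp⟩
  | succ s ih =>
    intro j hj hj1 c hc e he
    have he' := bcMono (hC3 j hj1) he
    have hsup : ∀ z ∈ ((B.toSubmodule ⊓ powSub N j) ⊔ C).baseChange A,
        ∃ b ∈ (B.toSubmodule ⊓ powSub N j).baseChange A, ∃ c ∈ C.baseChange A, z = b + c := by
      intro z hz
      refine baseChange_ind (P := fun z => ∃ b ∈ (B.toSubmodule ⊓ powSub N j).baseChange A,
        ∃ c ∈ C.baseChange A, z = b + c) ⟨0, zero_mem _, 0, zero_mem _, by simp⟩ ?_ ?_ z hz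
      · rintro _ _ ⟨b, hb, c, hc, rfl⟩ ⟨b', hb', c', hc', rfl⟩
        exact ⟨_, add_mem hb hb', _, add_mem hc hc', by ring⟩
      · intro a m hm
        obtain ⟨b, hb, c, hc, rfl⟩ := Submodule.mem_sup.1 hm
        exact ⟨_, Submodule.tmul_mem_baseChange_of_mem a hb, _,
          Submodule.tmul_mem_baseChange_of_mem a hc, by rw [TensorProduct.tmul_add]⟩
    obtain ⟨b, hb, c1, hc1, rfl⟩ := hsup e he'
    have hcN : c + (b + c1) ∈ (powSub N 1 : Submodule k E).baseChange A := by
      refine add_mem (bcMono hC1 hc) ?_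
      refine bcMono ?_ he
      exact fun x hx => Ideal.pow_le_pow_right hj1 (show x ∈ N ^ j from hx)
    have hbN : b ∈ (powSub N j : Submodule k E).baseChange A :=
      bcMono inf_le_right hb
    have he2 : -((c + (b + c1)) * b) ∈ (powSub N (j + 1) : Submodule k E).baseChange A := by
      rw [add_comm j 1]
      exact neg_mem (baseChange_mul (fun x hx y hy => powSub_mul hx hy) hcN hbN)
    obtain ⟨b', hb', c', hc', h⟩ := ih (j + 1) (by omega) (by omega) (c + c1) (add_mem hc hc1) _ he2
    have hb1 : b ∈ (B.toSubmodule ⊓ powSub N 1).baseChange A :=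
      bcMono (inf_le_inf_left _ fun x hx =>
        Ideal.pow_le_pow_right hj1 (show x ∈ N ^ j from hx)) hb
    have hbb : b * b' ∈ (B.toSubmodule ⊓ powSub N 1).baseChange A := by
      refine baseChange_mul (P := B.toSubmodule ⊓ powSub N 1) (Q := B.toSubmodule ⊓ powSub N 1)
        (fun x hx y hy => Submodule.mem_inf.2 ⟨B.mul_mem hx.1 hy.1, ?_⟩) hb1 hb'
      exact Ideal.mul_mem_left (N ^ 1) _ hy.2
    refine ⟨b' - b - b * b', sub_mem (sub_mem hb' hb1) hbb, c', hc', ?_⟩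
    rw [← h]; ring

lemma exists_proj (B C : Submodule k E) (h : Disjoint C B) :
    ∃ π : E →ₗ[k] C, (∀ c : C, π c = c) ∧ ∀ b ∈ B, π b = 0 := by
  obtain ⟨Q, hQ, hc⟩ := h.symm.exists_isCompl
  refine ⟨Submodule.projectionOnto C Q hc.symm, fun c =>
    Submodule.projectionOnto_apply_left hc.symm c, fun b hb => ?_⟩
  exact Submodule.projectionOnto_apply_right hc.symm ⟨b, hQ hb⟩

lemma factor_unique (B : Subalgebra k E) (N : Ideal E) (r : ℕ) (hr : N ^ r = ⊥)
    (C : Submodule k E) (hC1 : C ≤ powSub N 1) (hC2 : Disjoint C B.toSubmodule)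
    (hC3 : ∀ i, 1 ≤ i → (powSub N i : Submodule k E) ≤ (B.toSubmodule ⊓ powSub N i) ⊔ C)
    {c c' b : A ⊗[k] E} (hc : c ∈ C.baseChange A) (hc' : c' ∈ C.baseChange A)
    (hb : b ∈ (B.toSubmodule ⊓ powSub N 1).baseChange A) (h : 1 + c = (1 + c') * (1 + b)) :
    b = 0 := by
  obtain ⟨π, hπ1, hπ2⟩ := exists_proj B.toSubmodule C hC2
  set p : A ⊗[k] E →ₗ[A] A ⊗[k] E := (C.subtype.comp π).baseChange A with hp
  have hpC : ∀ z ∈ C.baseChange A, p z = z := by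
    intro z hz
    refine baseChange_ind (P := fun z => p z = z) (by simp) ?_ ?_ z hz
    · intro x y hx hy; rw [map_add, hx, hy]
    · intro a m hm
      rw [hp, LinearMap.baseChange_tmul]
      simp [hπ1 ⟨m, hm⟩]
  have hpB : ∀ z ∈ B.toSubmodule.baseChange A, p z = 0 := by
    intro z hz
    refine baseChange_ind (P := fun z => p z = 0) (by simp) ?_ ?_ z hz
    · intro x y hx hy; rw [map_add, hx, hy, add_zero]
    · intro a m hm
      rw [hp, LinearMap.baseChange_tmul]
      simp [hπ2 m hm]
  have key : ∀ j, 1 ≤ j → b ∈ (B.toSubmodule ⊓ powSub N j).baseChange A := by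
    intro j hj
    induction j, hj using Nat.le_induction with
    | base => exact hb
    | succ j hj ih =>
      have h1 : c' * b ∈ (powSub N (j + 1) : Submodule k E).baseChange A := by
        rw [add_comm j 1]
        exact baseChange_mul (fun x hx y hy => powSub_mul hx hy)
          (bcMono hC1 hc') (bcMono inf_le_right ih)
      have h2 : c' * b ∈ ((B.toSubmodule ⊓ powSub N (j + 1)) ⊔ C).baseChange A :=
        bcMono (hC3 _ (by omega)) h1
      have hsup : ∀ z ∈ ((B.toSubmodule ⊓ powSub N (j + 1)) ⊔ C).baseChange A,
          ∃ b ∈ (B.toSubmodule ⊓ powSub N (j + 1)).baseChange A,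
          ∃ c ∈ C.baseChange A, z = b + c := by
        intro z hz
        refine baseChange_ind (P := fun z => ∃ b ∈ (B.toSubmodule ⊓ powSub N (j + 1)).baseChange A,
          ∃ c ∈ C.baseChange A, z = b + c) ⟨0, zero_mem _, 0, zero_mem _, by simp⟩ ?_ ?_ z hz
        · rintro _ _ ⟨b, hb, c, hc, rfl⟩ ⟨b', hb', c', hc', rfl⟩
          exact ⟨_, add_mem hb hb', _, add_mem hc hc', by ring⟩
        · intro a m hm
          obtain ⟨b, hb, c, hc, rfl⟩ := Submodule.mem_sup.1 hm
          exact ⟨_, Submodule.tmul_mem_baseChange_of_mem a hb, _,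
            Submodule.tmul_mem_baseChange_of_mem a hc, by rw [TensorProduct.tmul_add]⟩
      obtain ⟨b2, hb2, c2, hc2, h3⟩ := hsup _ h2
      have h4 : c - c' - c2 = b + b2 := by linear_combination h + h3
      have h5 : p (c - c' - c2) = c - c' - c2 := hpC _ (sub_mem (sub_mem hc hc') hc2)
      have h6 : p (b + b2) = 0 := hpB _ (add_mem (bcMono inf_le_left hb)
        (bcMono inf_le_left hb2))
      have h7 : b = -b2 := by
        have : b + b2 = 0 := by rw [← h4, ← h5, h4, h6]
        exact eq_neg_of_add_eq_zero_left this
      rw [h7]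
      exact neg_mem hb2
  have h0 : (powSub N (r + 1) : Submodule k E) = ⊥ := by
    rw [eq_bot_iff]
    intro x hx
    have : x ∈ N ^ r := Ideal.pow_le_pow_right (by omega) (show x ∈ N ^ (r + 1) from hx)
    rw [hr] at this
    exact this
  have := bcMono inf_le_right (key (r + 1) (by omega))
  rwa [h0, Submodule.baseChange_bot, Submodule.mem_bot] at this

/-- Evaluation over `A` of a `k`-point of `E`. -/
noncomputable def evalA (A : Type u) [CommRing A] [Algebra k A] (p : E →ₐ[k] k) :
    A ⊗[k] E →ₐ[A] A :=
  Algebra.TensorProduct.lift (AlgHom.id A A) ((Algebra.ofId k A).comp p) fun _ _ => Commute.all _ _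

@[simp] lemma evalA_tmul (p : E →ₐ[k] k) (a : A) (x : E) :
    evalA A p (a ⊗ₜ x) = a * algebraMap k A (p x) := by
  simp [evalA, Algebra.ofId_apply]

/-- The normal form `(∑ aᵢ ⊗ εᵢ) (1 + ∑ yⱼ ⊗ βⱼ)`. -/
noncomputable def normalForm {ι κ : Type} [Fintype ι] [Fintype κ] (ε : ι → E) (β : κ → E)
    (a : ι → A) (y : κ → A) : A ⊗[k] E :=
  (∑ i, a i ⊗ₜ ε i) * (1 + ∑ j, y j ⊗ₜ β j)

/-- Existence of the coset variety when `E` is finite over `k`, is a product of local algebras with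
residue field `k`, and `B` has constant residues. -/
theorem nonempty_cosetModel [Module.Finite k E] (B : Subalgebra k E) {m : ℕ}
    (ε : Fin (m + 1) → E) (p : Fin (m + 1) → E →ₐ[k] k)
    (hpε : ∀ i j, p i (ε j) = if i = j then 1 else 0)
    (hεε : ∀ i j, ε i * ε j = if i = j then ε i else 0) (hε : ∑ i, ε i = 1)
    (N : Ideal E) (hN : ∀ x, x ∈ N ↔ ∀ i, p i x = 0) (r : ℕ) (hr : N ^ r = ⊥)
    (hB : ∀ b ∈ B, ∀ i, p i b = p 0 b) :
    Nonempty (CosetModel B) := by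
  classical
  obtain ⟨C, hC1, hC2, hC3⟩ := exists_adapted B.toSubmodule N r hr r 1 (by omega)
  obtain ⟨π, hπ1, hπ2⟩ := exists_proj B.toSubmodule C hC2
  set β := Module.finBasis k C with hβ
  set n := Module.finrank k C with hn
  set bb : Fin n → E := fun j => (β j : E) with hbb
  have hpN : ∀ (A : Type u) [CommRing A] [Algebra k A] (i) (z : A ⊗[k] E),
      z ∈ (powSub N 1 : Submodule k E).baseChange A → evalA A (p i) z = 0 := by
    intro A _ _ i z hz
    refine baseChange_ind (P := fun z => evalA A (p i) z = 0) (by simp) ?_ ?_ z hz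
    · intro x y hx hy; rw [map_add, hx, hy, add_zero]
    · intro a m hm
      have : m ∈ N := by simpa [powSub] using hm
      simp [(hN m).1 this i]
  have hdiag : ∀ (A : Type u) [CommRing A] [Algebra k A] (a a' : Fin (m + 1) → A),
      (∑ i, a i ⊗ₜ[k] ε i) * (∑ i, a' i ⊗ₜ[k] ε i) = ∑ i, (a i * a' i) ⊗ₜ[k] ε i := by
    intro A _ _ a a'
    rw [Finset.sum_mul_sum]
    refine Finset.sum_congr rfl fun i _ => ?_
    rw [Finset.sum_eq_single i]
    · simp [hεε]
    · intro j _ hj; simp [hεε, hj.symm]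
    · simp
  have hdiag1 : ∀ (A : Type u) [CommRing A] [Algebra k A],
      (∑ i, (1 : A) ⊗ₜ[k] ε i) = 1 := by
    intro A _ _
    rw [← TensorProduct.tmul_sum, hε, Algebra.TensorProduct.one_def]
  have hdec : ∀ (A : Type u) [CommRing A] [Algebra k A] (z : A ⊗[k] E),
      z - ∑ i, evalA A (p i) z ⊗ₜ ε i ∈ (powSub N 1 : Submodule k E).baseChange A := by
    intro A _ _ z
    induction z with
    | zero => simp
    | add x y hx hy =>
      have := add_mem hx hy
      simp only [map_add, TensorProduct.add_tmul, Finset.sum_add_distrib]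
      convert this using 1
      ring
    | tmul a x =>
      have : (a ⊗ₜ[k] x - ∑ i, evalA A (p i) (a ⊗ₜ[k] x) ⊗ₜ[k] ε i) =
          a ⊗ₜ[k] (x - ∑ i, p i x • ε i) := by
        rw [TensorProduct.tmul_sub, TensorProduct.tmul_sum]
        congr 1
        refine Finset.sum_congr rfl fun i _ => ?_
        rw [evalA_tmul, mul_comm, ← Algebra.smul_def, TensorProduct.smul_tmul]
      rw [this]
      refine Submodule.tmul_mem_baseChange_of_mem _ ?_
      change _ ∈ N ^ 1
      rw [pow_one, hN]
      intro i
      simp [hpε]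
  have hBdec : ∀ (A : Type u) [CommRing A] [Algebra k A] (z : A ⊗[k] E), z ∈ B.baseChange A →
      (∀ i, evalA A (p i) z = evalA A (p 0) z) ∧
      z - evalA A (p 0) z ⊗ₜ 1 ∈ (B.toSubmodule ⊓ powSub N 1).baseChange A := by
    intro A _ _ z hz
    obtain ⟨w, rfl⟩ := hz
    induction w with
    | zero => simp
    | add x y hx hy =>
      refine ⟨fun i => by simp only [map_add]; rw [hx.1 i, hy.1 i], ?_⟩
      have := add_mem hx.2 hy.2
      simp only [map_add, TensorProduct.add_tmul]
      convert this using 1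
      simp only [AlgHom.toRingHom_eq_coe, RingHom.coe_coe]
      ring
    | tmul a b =>
      have hb := hB b b.2
      refine ⟨fun i => ?_, ?_⟩
      · simp [hb i]
      · have : ((Algebra.TensorProduct.map (AlgHom.id A A) B.val).toRingHom (a ⊗ₜ[k] b)) -
            (evalA A (p 0)) ((Algebra.TensorProduct.map (AlgHom.id A A) B.val).toRingHom
              (a ⊗ₜ[k] b)) ⊗ₜ[k] (1 : E) = a ⊗ₜ[k] ((b : E) - p 0 b • 1) := by
          simp only [AlgHom.toRingHom_eq_coe, RingHom.coe_coe, Algebra.TensorProduct.map_tmul,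
            AlgHom.coe_id, id_eq, Subalgebra.coe_val, evalA_tmul]
          rw [TensorProduct.tmul_sub, mul_comm, ← Algebra.smul_def, TensorProduct.smul_tmul]
        rw [this]
        refine Submodule.tmul_mem_baseChange_of_mem _ ⟨?_, ?_⟩
        · exact B.sub_mem b.2 (B.smul_mem B.one_mem _)
        · change _ ∈ N ^ 1
          rw [pow_one, hN]
          intro i
          simp [hb i]
  have hBsub : ∀ (A : Type u) [CommRing A] [Algebra k A] (z : A ⊗[k] E),
      z ∈ B.toSubmodule.baseChange A → z ∈ B.baseChange A := by
    intro A _ _ z hz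
    refine baseChange_ind (P := fun z => z ∈ B.baseChange A) (zero_mem _) ?_ ?_ z hz
    · intro x y hx hy; exact add_mem hx hy
    · intro a m hm; exact Subalgebra.tmul_mem_baseChange hm a
  have hnil : ∀ (A : Type u) [CommRing A] [Algebra k A] (z : A ⊗[k] E),
      z ∈ (powSub N 1 : Submodule k E).baseChange A → z ^ r = 0 := by
    intro A _ _ z hz
    have : ∀ j, z ^ j ∈ (powSub N j : Submodule k E).baseChange A := by
      intro j
      induction j with
      | zero =>
        rw [pow_zero, Algebra.TensorProduct.one_def]
        exact Submodule.tmul_mem_baseChange_of_mem _ (by simp [powSub])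
      | succ j ih =>
        rw [pow_succ]
        exact baseChange_mul (fun x hx y hy => powSub_mul hx hy) ih hz
    have h := this r
    have h0 : (powSub N r : Submodule k E) = ⊥ := by
      rw [eq_bot_iff]
      intro x hx
      have : x ∈ N ^ r := hx
      rwa [hr] at this
    rwa [h0, Submodule.baseChange_bot, Submodule.mem_bot] at h
  have hbbC : ∀ (A : Type u) [CommRing A] [Algebra k A] (y : Fin n → A),
      ∑ j, y j ⊗ₜ[k] bb j ∈ C.baseChange A := fun A _ _ y =>
    sum_mem fun j _ => Submodule.tmul_mem_baseChange_of_mem _ (β j).2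
  have hunit1 : ∀ (A : Type u) [CommRing A] [Algebra k A] (z : A ⊗[k] E),
      z ∈ (powSub N 1 : Submodule k E).baseChange A → IsUnit (1 + z) := fun A _ _ z hz =>
    IsNilpotent.isUnit_one_add ⟨r, hnil A z hz⟩
  have hunitD : ∀ (A : Type u) [CommRing A] [Algebra k A] (a : Fin (m + 1) → Aˣ),
      (∑ i, (a i : A) ⊗ₜ[k] ε i) * (∑ i, ((a i)⁻¹ : Aˣ).val ⊗ₜ[k] ε i) = 1 := by
    intro A _ _ a
    rw [hdiag, ← hdiag1 A]
    simp
  have hnfunit : ∀ (A : Type u) [CommRing A] [Algebra k A] (a : Fin (m + 1) → A) (y : Fin n → A),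
      (∀ i, IsUnit (a i)) → IsUnit (normalForm ε bb a y : A ⊗[k] E) := by
    intro A _ _ a y ha
    choose a' ha' using ha
    refine IsUnit.mul ?_ (hunit1 A _ (bcMono hC1 (hbbC A y)))
    have := IsUnit.of_mul_eq_one _ (hunitD A a')
    simpa [ha'] using this
  have hnfeval : ∀ (A : Type u) [CommRing A] [Algebra k A] (a : Fin (m + 1) → A) (y : Fin n → A)
      (i), evalA A (p i) (normalForm ε bb a y : A ⊗[k] E) = a i := by
    intro A _ _ a y i
    rw [normalForm, map_mul, map_add, hpN A i _ (bcMono hC1 (hbbC A y))]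
    simp [hpε]
  -- the coordinate ring of the variety of normal forms
  let P := MvPolynomial (Fin m ⊕ Fin n) k
  let q : P := ∏ i : Fin m, MvPolynomial.X (Sum.inl i)
  let R := Localization.Away q
  have hRft : Algebra.FiniteType k R :=
    Algebra.FiniteType.trans (S := P) inferInstance
      (inferInstanceAs (Algebra.FiniteType P (Localization.Away q)))
  let T : Fin (m + 1) → R := Fin.cons 1 fun i => algebraMap P R (MvPolynomial.X (Sum.inl i))
  let Y : Fin n → R := fun j => algebraMap P R (MvPolynomial.X (Sum.inr j))
  have hT : ∀ i, IsUnit (T i) := by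
    intro i
    refine Fin.cases (by simp [T]) (fun i => ?_) i
    have h : IsUnit (algebraMap P R q) := IsLocalization.Away.algebraMap_isUnit q
    have hd : (MvPolynomial.X (Sum.inl i) : P) ∣ q := Finset.dvd_prod_of_mem _ (Finset.mem_univ i)
    simpa [T] using isUnit_of_dvd_unit (map_dvd (algebraMap P R) hd) h
  let μ : (R ⊗[k] E)ˣ := (hnfunit R T Y hT).unit
  have hμ : ∀ (A : Type u) [CommRing A] [Algebra k A] (f : R →ₐ[k] A),
      (unitMap E f μ : A ⊗[k] E) = normalForm ε bb (f ∘ T) (f ∘ Y) := by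
    intro A _ _ f
    simp [unitMap, μ, normalForm]
  refine ⟨{ coordRing := R, finiteType := hRft, point := μ, universal := ?_ }⟩
  intro A _ _ x
  refine existsUnique_of_exists_of_unique ?_ ?_
  · have ha : ∀ i, IsUnit (evalA A (p i) x) := fun i => x.isUnit.map _
    choose a ha using ha
    let D : A ⊗[k] E := ∑ i, (a i : A) ⊗ₜ[k] ε i
    let D' : A ⊗[k] E := ∑ i, ((a i)⁻¹ : Aˣ).val ⊗ₜ[k] ε i
    have hDD : D * D' = 1 := hunitD A a
    have hxD : (x : A ⊗[k] E) - D ∈ (powSub N 1 : Submodule k E).baseChange A := by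
      have := hdec A x
      simpa only [← ha] using this
    have he : D' * (x - D) ∈ (powSub N 1 : Submodule k E).baseChange A := by
      refine baseChange_mul (P := ⊤) (fun x _ y hy => ?_) (by simp) hxD
      exact Ideal.mul_mem_left (N ^ 1) _ hy
    obtain ⟨b, hb, c, hc, hbc⟩ := factor_exists B N r hr C hC1 hC3 r 1 (by omega) le_rfl 0
      (zero_mem _) _ he
    have hbN : b ∈ (powSub N 1 : Submodule k E).baseChange A :=
      bcMono inf_le_right hb
    have hcy : ∃ y : Fin n → A, c = ∑ j, y j ⊗ₜ[k] bb j := by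
      refine baseChange_ind (P := fun c => ∃ y : Fin n → A, c = ∑ j, y j ⊗ₜ[k] bb j)
        ⟨0, by simp⟩ ?_ ?_ c hc
      · rintro _ _ ⟨y, rfl⟩ ⟨y', rfl⟩
        exact ⟨y + y', by simp [TensorProduct.add_tmul, Finset.sum_add_distrib]⟩
      · intro s e he
        refine ⟨fun j => β.repr ⟨e, he⟩ j • s, ?_⟩
        have h1 := congrArg (Subtype.val) (β.sum_repr ⟨e, he⟩)
        rw [AddSubmonoidClass.coe_finsetSum] at h1
        have h2 : e = ∑ j, β.repr ⟨e, he⟩ j • bb j := h1.symm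
        conv_lhs => rw [h2]
        rw [TensorProduct.tmul_sum]
        exact Finset.sum_congr rfl fun j _ => by rw [TensorProduct.smul_tmul]
    obtain ⟨y, rfl⟩ := hcy
    let g : Fin m ⊕ Fin n → A := Sum.elim (fun i => a i.succ * ((a 0)⁻¹ : Aˣ).val) y
    have hg : ∀ z : Submonoid.powers q, IsUnit (MvPolynomial.aeval g (z : P)) := by
      rintro ⟨_, l, rfl⟩
      simp only [map_pow]
      refine IsUnit.pow _ ?_
      simp only [q, map_prod, MvPolynomial.aeval_X]
      rw [IsUnit.prod_univ_iff]
      intro i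
      simp [g]
    let f : R →ₐ[k] A := IsLocalization.liftAlgHom (M := Submonoid.powers q) hg
    have hf : ∀ z : P, f (algebraMap P R z) = MvPolynomial.aeval g z := fun z =>
      IsLocalization.lift_eq _ z
    have hfT : f ∘ T = fun i => (a i : A) * ((a 0)⁻¹ : Aˣ).val := by
      funext i
      refine Fin.cases (by simp [T]) (fun i => ?_) i
      simp [T, hf, g]
    have hfY : f ∘ Y = y := by
      funext j
      simp [Y, hf, g]
    refine ⟨f, ?_⟩
    have hval : (unitMap E f μ : A ⊗[k] E) =
        (x : A ⊗[k] E) * ((((a 0)⁻¹ : Aˣ).val ⊗ₜ[k] 1) * (1 + b)) := by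
      rw [hμ, hfT, hfY, normalForm, ← hbc]
      have h1 : (∑ i, ((a i : A) * ((a 0)⁻¹ : Aˣ).val) ⊗ₜ[k] ε i) =
          D * (((a 0)⁻¹ : Aˣ).val ⊗ₜ[k] 1) := by
        simp [D, Finset.sum_mul]
      rw [h1]
      linear_combination (((a 0)⁻¹ : Aˣ).val ⊗ₜ[k] (1 : E)) * (1 + b) * ((x : A ⊗[k] E) - D) * hDD
    have hbu : IsUnit (⟨1 + b, add_mem (one_mem _)
        (hBsub A b (bcMono inf_le_left hb))⟩ : B.baseChange A) := by
      have : IsNilpotent (⟨b, hBsub A b (bcMono inf_le_left hb)⟩ :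
          B.baseChange A) := ⟨r, Subtype.ext (by simpa using hnil A b hbN)⟩
      exact this.isUnit_one_add
    let v := hbu.unit
    have hv : v.val = _ := hbu.unit_spec
    let vu : (A ⊗[k] E)ˣ := Units.map (B.baseChange A).val.toRingHom.toMonoidHom v
    have hvu : (vu : A ⊗[k] E) = 1 + b := congrArg Subtype.val hv
    have hvmem : vu ∈ unitSubgroup B A :=
      ⟨v.val.2, (v⁻¹).val.2⟩
    let su : (A ⊗[k] E)ˣ := Units.map
      (Algebra.TensorProduct.includeLeft : A →ₐ[k] A ⊗[k] E).toRingHom.toMonoidHom (a 0)⁻¹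
    have hsmem : su ∈ unitSubgroup B A := by
      refine ⟨?_, ?_⟩
      · exact Subalgebra.tmul_mem_baseChange B.one_mem _
      · exact Subalgebra.tmul_mem_baseChange B.one_mem _
    rw [eq_comm, QuotientGroup.eq]
    have : x⁻¹ * unitMap E f μ = su * vu := by
      rw [inv_mul_eq_iff_eq_mul]
      ext
      rw [hval, Units.val_mul, Units.val_mul, hvu]
      rfl
    rw [this]
    exact mul_mem hsmem hvmem
  · intro f f' hf hf'
    have hq := hf.trans hf'.symm
    rw [eq_comm, QuotientGroup.eq] at hq
    obtain ⟨hq1, -⟩ := hq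
    set h : A ⊗[k] E := (((unitMap E f' μ)⁻¹ * unitMap E f μ : (A ⊗[k] E)ˣ) : A ⊗[k] E) with hh
    have hmul : (unitMap E f μ : A ⊗[k] E) = unitMap E f' μ * h := by
      rw [hh, ← Units.val_mul, mul_inv_cancel_left]
    rw [hμ, hμ] at hmul
    obtain ⟨he1, he2⟩ := hBdec A h hq1
    have hTi : ∀ i, f (T i) = f' (T i) * evalA A (p 0) h := by
      intro i
      have := congrArg (evalA A (p i)) hmul
      rw [map_mul, hnfeval, hnfeval, he1] at this
      exact this
    have h1 : evalA A (p 0) h = 1 := by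
      have := hTi 0
      simpa [T] using this.symm
    have hTT : f ∘ T = f' ∘ T := by
      funext i
      simpa [h1] using hTi i
    rw [h1, ← Algebra.TensorProduct.one_def] at he2
    set b := h - 1 with hb
    have hh1 : h = 1 + b := by rw [hb]; ring
    have hDu : IsUnit (∑ i, (f' ∘ T) i ⊗ₜ[k] ε i) := by
      have : ∀ i, IsUnit (f' (T i)) := fun i => (hT i).map f'
      choose a ha using this
      have := IsUnit.of_mul_eq_one _ (hunitD A a)
      simpa [ha] using this
    rw [normalForm, normalForm, hTT, mul_assoc, hDu.mul_right_inj, hh1] at hmul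
    have hb0 := factor_unique B N r hr C hC1 hC2 hC3 (hbbC A _) (hbbC A _) he2 hmul
    rw [hb0, add_zero, mul_one, add_right_inj] at hmul
    have hYY : ∀ j, f (Y j) = f' (Y j) := by
      intro j
      have := congrArg (Module.Dual.baseChange A ((β.coord j).comp π)) hmul
      simpa [Module.Dual.baseChange_apply_tmul, hbb, hπ1, Finsupp.single_apply] using this
    refine IsLocalization.algHom_ext (Submonoid.powers q) ?_
    refine MvPolynomial.algHom_ext ?_
    rintro (i | j)
    · have := congrFun hTT i.succ
      simp only [T, Function.comp, Fin.cons_succ] at this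
      exact this
    · exact hYY j

theorem nonempty_cosetModel_of_subsingleton [Subsingleton E] (B : Subalgebra k E) :
    Nonempty (CosetModel B) := by
  refine ⟨{ coordRing := k, point := 1, universal := fun A _ _ x => ?_ }⟩
  have : Subsingleton (A ⊗[k] E) := ⟨fun a b => by
    have h0 : (1 : A ⊗[k] E) = 0 := by
      rw [Algebra.TensorProduct.one_def, Subsingleton.elim (1 : E) 0, TensorProduct.tmul_zero]
    rw [← one_mul a, ← one_mul b, h0, zero_mul, zero_mul]⟩
  have h : Subsingleton (A ⊗[k] E)ˣ := ⟨fun a b => Units.ext (Subsingleton.elim _ _)⟩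
  exact ⟨Algebra.ofId k A, congrArg _ (Subsingleton.elim _ _), fun f _ => Subsingleton.elim _ _⟩

lemma mem_baseChange_iff (B : Subalgebra k E) (z : A ⊗[k] E) :
    z ∈ B.baseChange A ↔ ∀ l : Module.Dual k E, (∀ b ∈ B, l b = 0) → l.baseChange A z = 0 := by
  constructor
  · rintro ⟨w, rfl⟩ l hl
    induction w with
    | zero => simp
    | add x y hx hy => simp only [map_add, hx, hy, add_zero]
    | tmul a b => simp [Module.Dual.baseChange_apply_tmul, hl b b.2]
  · intro h
    obtain ⟨Q, hQ⟩ := Submodule.exists_isCompl B.toSubmodule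
    let π : E →ₗ[k] Q := Submodule.projectionOnto Q _ hQ.symm
    have hπB : ∀ b ∈ B, π b = 0 := fun b hb =>
      Submodule.projectionOnto_apply_right hQ.symm ⟨b, hb⟩
    have hπQ : ∀ e : Q, π e = e := fun e => Submodule.projectionOnto_apply_left hQ.symm e
    have h1 : z - (Q.subtype.baseChange A) (π.baseChange A z) ∈ B.baseChange A := by
      clear h
      induction z with
      | zero => simp
      | add x y hx hy =>
        have := add_mem hx hy
        simp only [map_add]
        convert this using 1
        ring
      | tmul a e =>
        rw [LinearMap.baseChange_tmul, LinearMap.baseChange_tmul, ← TensorProduct.tmul_sub]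
        refine Subalgebra.tmul_mem_baseChange ?_ a
        have he : e ∈ B.toSubmodule ⊔ Q := by rw [hQ.sup_eq_top]; trivial
        obtain ⟨b, hb, c, hc, rfl⟩ := Submodule.mem_sup.1 he
        have hc' := hπQ ⟨c, hc⟩
        simp only [map_add, hπB b hb, zero_add] at hc' ⊢
        rw [hc']
        simpa using hb
    have h2 : π.baseChange A z = 0 := by
      let b := Module.Basis.ofVectorSpace k Q
      refine (b.baseChange A).ext_elem fun i => ?_
      have h3 : ∀ w : A ⊗[k] E, (b.baseChange A).repr (π.baseChange A w) i =
          Module.Dual.baseChange A ((b.coord i).comp π) w := by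
        intro w
        induction w with
        | zero => simp
        | add x y hx hy => simp only [map_add, Finsupp.add_apply, hx, hy]
        | tmul a e =>
          rw [LinearMap.baseChange_tmul, Module.Basis.baseChange_repr_tmul,
            Module.Dual.baseChange_apply_tmul]
          simp
      rw [h3, h _ fun c hc => by simp [hπB c hc]]
      simp
    rwa [h2, map_zero, sub_zero] at h1

/-- The ideal of the closed subvariety of the coset variety defined by the condition `τ μ ∈ B`,
i.e. by the vanishing at `τ μ` of all linear forms on `E` that vanish on `B`. -/
noncomputable def CosetModel.condIdeal {B : Subalgebra k E} (J : CosetModel B) (τ : E) :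
    Ideal J.coordRing :=
  Ideal.span {a | ∃ l : Module.Dual k E, (∀ b ∈ B, l b = 0) ∧
    a = l.baseChange J.coordRing ((1 ⊗ₜ τ) * (J.point : J.coordRing ⊗[k] E))}

/-- `J.condIdeal τ` cuts out exactly the cosets `[μ]` with `τ μ ∈ A ⊗ B`. -/
lemma CosetModel.condIdeal_le_ker_iff {B : Subalgebra k E} (J : CosetModel B) (τ : E)
    (f : J.coordRing →ₐ[k] A) :
    J.condIdeal τ ≤ RingHom.ker f ↔
      (1 ⊗ₜ τ) * (unitMap E f J.point : A ⊗[k] E) ∈ B.baseChange A := by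
  have hz : ∀ l : Module.Dual k E,
      f (l.baseChange J.coordRing ((1 ⊗ₜ τ) * (J.point : J.coordRing ⊗[k] E))) =
        l.baseChange A ((1 ⊗ₜ τ) * (unitMap E f J.point : A ⊗[k] E)) := by
    intro l
    have h1 : ∀ w : J.coordRing ⊗[k] E, f (l.baseChange J.coordRing w) =
        l.baseChange A (Algebra.TensorProduct.map f (AlgHom.id k E) w) := by
      intro w
      induction w with
      | zero => simp
      | add x y hx hy => simp only [map_add, hx, hy]
      | tmul a e => simp [Module.Dual.baseChange_apply_tmul]
    rw [h1, map_mul]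
    simp [unitMap]
  rw [CosetModel.condIdeal, Ideal.span_le, mem_baseChange_iff]
  constructor
  · intro h l hl
    rw [← hz]
    exact h ⟨l, hl, rfl⟩
  · rintro h _ ⟨l, hl, rfl⟩
    change f _ = 0
    rw [hz]
    exact h l hl

end Universal
/-! ### Totally rational rings and their zeta functions -/

/-- A totally rational ring `𝒪` with `d` branches: a local `k`-subalgebra of finite codimension of
its normalization `𝒪~ = k⟦t₁⟧ × ⋯ × k⟦t_d⟧`. Complete local rings of algebraic curves
over `k` at points all of whose preimages in the normalization are `k`-rational are of this form.
(Being local, `𝒪` is nonzero, so `d ≥ 1`.) -/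
structure TotallyRationalRing (k : Type u) [Field k] (d : ℕ) where
  toSubalgebra : Subalgebra k (Fin d → PowerSeries k)
  isLocalRing : IsLocalRing toSubalgebra
  finite_codim : Module.Finite k ((Fin d → PowerSeries k) ⧸ Subalgebra.toSubmodule toSubalgebra)

namespace TotallyRationalRing
variable {k : Type u} [Field k] {d : ℕ} (O : TotallyRationalRing k d)

/-- The semigroup `S` of values: all `v(z) = (v₁(z₁), …, v_d(z_d))` for `z ∈ 𝒪` not a
zero divisor, i.e. with all `vᵢ(zᵢ)` finite. -/
def valueSemigroup : Set (Fin d → ℕ) :=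
  {n | ∃ z ∈ O.toSubalgebra, ∀ i, (z i).order = n i}

/-- The conductor `c` of `S`: the least `c` with `c + ℕᵈ ⊆ S` (see `isLeast_conductor`). -/
noncomputable def conductor : Fin d → ℕ :=
  sInf {c | ∀ n, c ≤ n → n ∈ O.valueSemigroup}

/-- `tⁿ = (t₁ ^ n₁, …, t_d ^ n_d)`. -/
noncomputable def tPow (k : Type u) [Field k] {d : ℕ} (n : Fin d → ℕ) : Fin d → PowerSeries k :=
  fun i => PowerSeries.X ^ n i

/-- The conductor ideal `𝓕 = t^c 𝒪~`, which is contained in `𝒪` (see `conductorIdeal_le`). -/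
noncomputable def conductorIdeal : Ideal (Fin d → PowerSeries k) :=
  Ideal.span {tPow k O.conductor}

lemma mem_span_tPow (c : Fin d → ℕ) (x : Fin d → PowerSeries k) :
    x ∈ Ideal.span {tPow k c} ↔ ∀ i, PowerSeries.X ^ c i ∣ x i := by
  rw [Ideal.mem_span_singleton]
  constructor
  · rintro ⟨y, rfl⟩ i
    exact ⟨y i, rfl⟩
  · intro h
    choose y hy using h
    exact ⟨y, funext hy⟩

lemma exists_pow_mul_mem : ∃ M : ℕ, ∀ x : Fin d → PowerSeries k,
    (∀ i, PowerSeries.X ^ M ∣ x i) → x ∈ O.toSubalgebra := by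
  have := O.finite_codim
  set Os := Subalgebra.toSubmodule O.toSubalgebra with hOs
  obtain ⟨r, s, hs⟩ := Module.Finite.exists_fin (R := k)
    (M := (Fin d → PowerSeries k) ⧸ Os)
  choose y hy using fun j => Submodule.mkQ_surjective Os (s j)
  let φ : (Fin d → PowerSeries k) →ₗ[k]
      (((Fin d → PowerSeries k) ⧸ Os) × (Fin r → (Fin d → PowerSeries k) ⧸ Os)) :=
    Os.mkQ.prod (LinearMap.pi fun j => Os.mkQ ∘ₗ LinearMap.mulRight k (y j))
  have hφ : ∀ x, φ x = 0 → ∀ z, x * z ∈ O.toSubalgebra := by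
    intro x hx z
    have hx1 : x ∈ Os := by
      have := congrArg Prod.fst hx
      simpa [φ] using this
    have hx2 : ∀ j, x * y j ∈ Os := by
      intro j
      have := congrFun (congrArg Prod.snd hx) j
      simpa [φ] using this
    have hz : Os.mkQ z ∈ Submodule.span k (Set.range s) := by rw [hs]; trivial
    obtain ⟨a, ha⟩ := (Submodule.mem_span_range_iff_exists_fun k).1 hz
    have h1 : z - ∑ j, a j • y j ∈ Os := by
      rw [← Submodule.ker_mkQ Os, LinearMap.mem_ker, map_sub, map_sum, ← ha]
      simp [hy]
    have h2 : x * z = x * (z - ∑ j, a j • y j) + ∑ j, a j • (x * y j) := by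
      rw [mul_sub, Finset.mul_sum]
      simp
    rw [h2]
    exact O.toSubalgebra.add_mem (O.toSubalgebra.mul_mem hx1 h1)
      (Subalgebra.sum_mem _ fun j _ => O.toSubalgebra.smul_mem (hx2 j) _)
  let ψ : Polynomial k →ₗ[k] (Fin d → PowerSeries k) :=
    (Polynomial.aeval (fun _ => PowerSeries.X : Fin d → PowerSeries k)).toLinearMap
  have hni : ¬ Function.Injective (φ ∘ₗ ψ) := fun h =>
    Polynomial.not_finite (R := k) (Module.Finite.of_injective _ h)
  obtain ⟨p, hp, hp0⟩ : ∃ p, (φ ∘ₗ ψ) p = 0 ∧ p ≠ 0 := by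
    by_contra! hcon
    exact hni ((injective_iff_map_eq_zero _).2 hcon)
  obtain ⟨q, hq, hq0⟩ := Polynomial.exists_eq_pow_rootMultiplicity_mul_and_not_dvd p hp0 0
  set M := p.rootMultiplicity 0
  rw [Polynomial.C_0, sub_zero] at hq hq0
  have hψ : ∀ (f : Polynomial k) (i), ψ f i = (f : PowerSeries k) := by
    intro f i
    have : ((Pi.evalAlgHom k (fun _ : Fin d => PowerSeries k) i).comp
        (Polynomial.aeval (fun _ => PowerSeries.X : Fin d → PowerSeries k))) =
        Polynomial.coeToPowerSeries.algHom k := by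
      ext
      simp [Polynomial.coeToPowerSeries.algHom_apply]
    have h := DFunLike.congr_fun this f
    simpa [ψ, Polynomial.coeToPowerSeries.algHom_apply] using h
  have hqc : PowerSeries.constantCoeff (q : PowerSeries k) ≠ 0 := by
    rw [Polynomial.constantCoeff_coe]
    intro h
    exact hq0 (Polynomial.X_dvd_iff.2 (by simpa [Polynomial.constantCoeff_apply] using h))
  refine ⟨M, fun x hx => ?_⟩
  choose z hz using hx
  have : x = ψ p * fun i => (q : PowerSeries k)⁻¹ * z i := by
    funext i
    rw [Pi.mul_apply, hψ, hz, hq, Polynomial.coe_mul, Polynomial.coe_pow, Polynomial.coe_X,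
      ← mul_assoc, mul_assoc _ (q : PowerSeries k), PowerSeries.mul_inv_cancel _ hqc, mul_one]
  rw [this]
  exact hφ _ hp _

lemma conductorSet_nonempty : {c | ∀ n, c ≤ n → n ∈ O.valueSemigroup}.Nonempty := by
  obtain ⟨M, hM⟩ := O.exists_pow_mul_mem
  refine ⟨fun _ => M, fun n hn => ⟨tPow k n, hM _ fun i => pow_dvd_pow _ (hn i), fun i => ?_⟩⟩
  simp [tPow, PowerSeries.order_X_pow]

/-- The set of all `c` with `c + ℕᵈ ⊆ S` has a least element, and it is `conductor`. -/
lemma isLeast_conductor :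
    IsLeast {c | ∀ n, c ≤ n → n ∈ O.valueSemigroup} O.conductor := by
  set s := {c | ∀ n, c ≤ n → n ∈ O.valueSemigroup} with hs
  have hne : Nonempty s := O.conductorSet_nonempty.to_subtype
  have hc : ∀ i, O.conductor i = ⨅ f : s, (f : Fin d → ℕ) i := fun i => by
    rw [conductor, sInf_apply]
  constructor
  · intro n hn
    have h1 : ∀ i, ∃ c ∈ s, c i ≤ n i := by
      intro i
      obtain ⟨f, hf⟩ := ciInf_mem (fun f : s => (f : Fin d → ℕ) i)
      exact ⟨f, f.2, (hf.trans (hc i).symm).le.trans (hn i)⟩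
    choose c hcs hcn using h1
    have h2 : ∀ i, (fun j => if j = i then n j else max (n j + 1) (c i j)) ∈ O.valueSemigroup := by
      intro i
      refine hcs i _ fun j => ?_
      by_cases h : j = i
      · subst h; simpa using hcn j
      · simp [h]
    choose z hz hzo using h2
    refine ⟨∑ i, z i, sum_mem fun i _ => hz i, fun j => ?_⟩
    rw [PowerSeries.order_eq_nat]
    have h3 : ∀ i m, i ≠ j → m ≤ n j → PowerSeries.coeff m (z i j) = 0 := by
      intro i m hij hm
      refine PowerSeries.coeff_of_lt_order _ ?_
      rw [hzo]
      simp only [if_neg hij.symm]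
      exact_mod_cast lt_of_le_of_lt hm (lt_of_lt_of_le (Nat.lt_succ_self _) (le_max_left _ _))
    have h4 := hzo j j
    simp only [if_true] at h4
    rw [PowerSeries.order_eq_nat] at h4
    have h5 : ∀ m ≤ n j, PowerSeries.coeff m ((∑ i, z i) j) = PowerSeries.coeff m (z j j) := by
      intro m hm
      rw [Finset.sum_apply, map_sum]
      exact Finset.sum_eq_single j (fun i _ hij => h3 i m hij hm) (by simp)
    exact ⟨by rw [h5 _ le_rfl]; exact h4.1, fun m hm => by rw [h5 _ hm.le]; exact h4.2 m hm⟩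
  · intro c hcs i
    rw [hc]
    exact ciInf_le (OrderBot.bddBelow _) (⟨c, hcs⟩ : s)

lemma conductorIdeal_le (x : Fin d → PowerSeries k) (hx : x ∈ O.conductorIdeal) :
    x ∈ O.toSubalgebra := by
  obtain ⟨M, hM⟩ := O.exists_pow_mul_mem
  have key : ∀ s : ℕ, ∀ n : Fin d → ℕ, O.conductor ≤ n → ∑ i, (M - n i) ≤ s →
      ∀ x : Fin d → PowerSeries k, (∀ i, PowerSeries.X ^ n i ∣ x i) → x ∈ O.toSubalgebra := by
    intro s
    induction s with
    | zero =>
      intro n _ hs x hx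
      refine hM x fun i => (pow_dvd_pow _ ?_).trans (hx i)
      have := (Finset.sum_eq_zero_iff.1 (Nat.le_zero.1 hs)) i (Finset.mem_univ i)
      omega
    | succ s ih =>
      intro n hn hs x hx
      by_cases hall : ∀ i, M ≤ n i
      · exact hM x fun i => (pow_dvd_pow _ (hall i)).trans (hx i)
      · push Not at hall
        obtain ⟨i, hi⟩ := hall
        obtain ⟨z, hz, hzo⟩ := O.isLeast_conductor.1 n hn
        have hz1 := fun j => PowerSeries.order_eq_nat.1 (hzo j)
        set a := PowerSeries.coeff (n i) (x i) / PowerSeries.coeff (n i) (z i) with ha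
        have hmem : x - a • z ∈ O.toSubalgebra := by
          refine ih (Function.update n i (n i + 1)) ?_ ?_ _ ?_
          · refine hn.trans fun j => ?_
            by_cases h : j = i
            · subst h; simp
            · simp [h]
          · have hlt : ∑ j, (M - Function.update n i (n i + 1) j) < ∑ j, (M - n j) := by
              refine Finset.sum_lt_sum (fun j _ => ?_) ⟨i, Finset.mem_univ i, ?_⟩
              · by_cases h : j = i
                · subst h; simp; omega
                · simp [h]
              · simp; omega
            omega
          · intro j
            rw [PowerSeries.X_pow_dvd_iff]
            intro m hm
            have hxj := PowerSeries.X_pow_dvd_iff.1 (hx j)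
            by_cases h : j = i
            · subst h
              rw [Function.update_self] at hm
              rcases Nat.lt_succ_iff_lt_or_eq.1 hm with h1 | rfl
              · simp [hxj m h1, (hz1 j).2 m h1]
              · simp [ha, div_mul_cancel₀ _ (hz1 j).1]
            · rw [Function.update_of_ne h] at hm
              simp [hxj m hm, (hz1 j).2 m hm]
        have := O.toSubalgebra.add_mem hmem (O.toSubalgebra.smul_mem hz a)
        simpa using this
  exact key _ O.conductor le_rfl le_rfl x ((mem_span_tPow _ _).1 hx)

lemma constantCoeff_eq {z : Fin d → PowerSeries k} (hz : z ∈ O.toSubalgebra) (i j : Fin d) :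
    PowerSeries.constantCoeff (z i) = PowerSeries.constantCoeff (z j) := by
  have := O.isLocalRing
  by_contra hne
  have hnon : ∀ l, (⟨z, hz⟩ - algebraMap k O.toSubalgebra (PowerSeries.constantCoeff (z l))) ∈
      nonunits O.toSubalgebra := by
    intro l hu
    have h1 := hu.map ((PowerSeries.constantCoeff (R := k)).comp
      ((Pi.evalRingHom (fun _ : Fin d => PowerSeries k) l).comp O.toSubalgebra.val.toRingHom))
    have h2 : ((PowerSeries.constantCoeff (R := k)).comp
      ((Pi.evalRingHom (fun _ : Fin d => PowerSeries k) l).comp O.toSubalgebra.val.toRingHom))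
      (⟨z, hz⟩ - algebraMap k O.toSubalgebra (PowerSeries.constantCoeff (z l))) = 0 := by
      simp
    rw [h2] at h1
    exact not_isUnit_zero h1
  have hneg : -(⟨z, hz⟩ - algebraMap k O.toSubalgebra (PowerSeries.constantCoeff (z i))) ∈
      nonunits O.toSubalgebra := by
    intro hu
    exact hnon i (by simpa using hu.neg)
  have hs := IsLocalRing.nonunits_add (hnon j) hneg
  have : (⟨z, hz⟩ - algebraMap k O.toSubalgebra (PowerSeries.constantCoeff (z j))) +
      -(⟨z, hz⟩ - algebraMap k O.toSubalgebra (PowerSeries.constantCoeff (z i))) =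
      algebraMap k O.toSubalgebra (PowerSeries.constantCoeff (z i) -
        PowerSeries.constantCoeff (z j)) := by
    rw [map_sub]; ring
  rw [this] at hs
  exact hs ((isUnit_iff_ne_zero.2 (sub_ne_zero.2 hne)).map _)

/-- `𝒪~ / 𝓕`. -/
abbrev Trunc : Type u := (Fin d → PowerSeries k) ⧸ O.conductorIdeal

/-- `𝒪 / 𝓕` as a subalgebra of `𝒪~ / 𝓕`. -/
noncomputable def truncSubalgebra : Subalgebra k O.Trunc :=
  O.toSubalgebra.map (Ideal.Quotient.mkₐ k O.conductorIdeal)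

lemma finite_trunc : Module.Finite k O.Trunc := by
  set M := ∑ i, O.conductor i with hM
  have hMi : ∀ i, O.conductor i ≤ M := fun i =>
    Finset.single_le_sum (f := O.conductor) (fun _ _ => Nat.zero_le _) (Finset.mem_univ i)
  let g : (Fin d → Fin M → k) →ₗ[k] O.Trunc :=
    (Ideal.Quotient.mkₐ k O.conductorIdeal).toLinearMap ∘ₗ LinearMap.pi fun i =>
      ∑ j : Fin M, (LinearMap.toSpanSingleton k (PowerSeries k) (PowerSeries.X ^ (j : ℕ))) ∘ₗ
        LinearMap.proj j ∘ₗ LinearMap.proj i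
  refine Module.Finite.of_surjective g fun x => ?_
  obtain ⟨x, rfl⟩ := Ideal.Quotient.mk_surjective x
  refine ⟨fun i j => PowerSeries.coeff j (x i), ?_⟩
  change Ideal.Quotient.mk _ _ = _
  rw [Ideal.Quotient.eq, conductorIdeal, mem_span_tPow]
  intro i
  refine (pow_dvd_pow _ (hMi i)).trans ?_
  rw [PowerSeries.X_pow_dvd_iff]
  intro m hm
  simp only [Pi.sub_apply, LinearMap.pi_apply, LinearMap.coe_sum, Finset.sum_apply, map_sub,
    LinearMap.comp_apply, LinearMap.proj_apply, LinearMap.toSpanSingleton_apply, map_sum,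
    map_smul, PowerSeries.coeff_X_pow, smul_eq_mul, mul_ite, mul_one, mul_zero]
  rw [Finset.sum_eq_single ⟨m, hm⟩]
  · simp
  · intro j _ hj
    rw [if_neg]
    rintro rfl
    exact hj rfl
  · simp


theorem nonempty_cosetModel : Nonempty (CosetModel O.truncSubalgebra) := by
  classical
  have := O.finite_trunc
  have hloc := O.isLocalRing
  obtain _ | m := d
  · have : Subsingleton O.Trunc :=
      (Ideal.Quotient.mk_surjective (I := O.conductorIdeal)).subsingleton
    exact nonempty_cosetModel_of_subsingleton _
  by_cases hpos : ∀ i, 1 ≤ O.conductor i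
  · let p0 : Fin (m + 1) → (Fin (m + 1) → PowerSeries k) →ₐ[k] k := fun i =>
      { (PowerSeries.constantCoeff (R := k)).comp
          (Pi.evalRingHom (fun _ : Fin (m + 1) => PowerSeries k) i) with
        commutes' := fun a => by simp }
    have hp0 : ∀ i x, p0 i x = PowerSeries.constantCoeff (x i) := fun _ _ => rfl
    let p : Fin (m + 1) → O.Trunc →ₐ[k] k := fun i =>
      Ideal.Quotient.liftₐ O.conductorIdeal (p0 i) fun x hx => by
        rw [hp0, ← PowerSeries.X_dvd_iff]
        exact (dvd_pow_self _ (by have := hpos i; omega)).trans ((mem_span_tPow _ _).1 hx i)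
    let q := Ideal.Quotient.mk O.conductorIdeal
    have hp : ∀ i x, p i (q x) = PowerSeries.constantCoeff (x i) := fun _ _ => rfl
    let N : Ideal O.Trunc := ⨅ i, RingHom.ker (p i)
    have hN : ∀ x, x ∈ N ↔ ∀ i, p i x = 0 := fun x => by
      simp [N]
    set M := ∑ i, O.conductor i with hM
    have hMi : ∀ i, O.conductor i ≤ M := fun i =>
      Finset.single_le_sum (f := O.conductor) (fun _ _ => Nat.zero_le _) (Finset.mem_univ i)
    have hNle : N ≤ Ideal.span {q fun _ => PowerSeries.X} := by
      intro x hx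
      obtain ⟨x, rfl⟩ := Ideal.Quotient.mk_surjective x
      rw [hN] at hx
      have h1 : ∀ i, PowerSeries.X ∣ x i := fun i => PowerSeries.X_dvd_iff.2 (hx i)
      choose y hy using h1
      rw [Ideal.mem_span_singleton]
      exact ⟨q y, by rw [← map_mul]; exact congrArg _ (funext hy)⟩
    have hNM : N ^ M = ⊥ := by
      rw [eq_bot_iff]
      refine (Ideal.pow_right_mono hNle M).trans ?_
      rw [Ideal.span_singleton_pow, ← map_pow, Ideal.span_singleton_le_iff_mem, Ideal.mem_bot,
        Ideal.Quotient.eq_zero_iff_mem, conductorIdeal, mem_span_tPow]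
      exact fun i => pow_dvd_pow _ (hMi i)
    refine CurveZeta.nonempty_cosetModel O.truncSubalgebra
      (fun i => q (Pi.single i 1)) p ?_ ?_ ?_ N hN M hNM ?_
    · intro i j
      rw [hp]
      by_cases h : i = j
      · subst h; simp
      · simp [h]
    · intro i j
      rw [← map_mul]
      by_cases h : i = j
      · subst h; simp [← Pi.single_mul]
      · rw [if_neg h, ← map_zero q]
        congr 1
        funext l
        by_cases h' : l = i
        · subst h'; simp [h]
        · simp [h']
    · rw [← map_sum, ← map_one q]
      congr 1
      funext l
      simp [Finset.sum_apply, Pi.single_apply]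
    · rintro _ ⟨z, hz, rfl⟩ i
      exact O.constantCoeff_eq hz i 0
  · push Not at hpos
    obtain ⟨i, hi⟩ := hpos
    have hi0 : O.conductor i = 0 := by omega
    have hall : ∀ j, j = i := by
      intro j
      by_contra hj
      obtain ⟨z, hz, hzo⟩ := O.isLeast_conductor.1
        (fun l => if l = i then 0 else O.conductor l + 1) fun l => by
          by_cases h : l = i
          · subst h; simp [hi0]
          · simp [h]
      have h1 := PowerSeries.order_eq_nat.1 (hzo i)
      have h2 := PowerSeries.order_eq_nat.1 (hzo j)
      simp only [if_true, if_neg hj] at h1 h2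
      have h3 := h2.2 0 (Nat.succ_pos _)
      rw [PowerSeries.coeff_zero_eq_constantCoeff_apply] at h1 h3
      exact h1.1 ((O.constantCoeff_eq hz i j).trans h3)
    have htop : O.conductorIdeal = ⊤ := by
      rw [Ideal.eq_top_iff_one, conductorIdeal, mem_span_tPow]
      intro j
      rw [hall j, hi0, pow_zero]
      exact one_dvd _
    have : Subsingleton O.Trunc := Ideal.Quotient.subsingleton_iff.2 htop
    exact nonempty_cosetModel_of_subsingleton _

/-- The coset variety of `(𝒪~ / 𝓕)ˣ ⧸ (𝒪 / 𝓕)ˣ`. -/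
noncomputable def cosetModel : CosetModel O.truncSubalgebra :=
  Classical.choice O.nonempty_cosetModel

/-- The algebraic group `𝒥 = 𝒪~ˣ ⧸ 𝒪ˣ = (𝒪~ / 𝓕)ˣ ⧸ (𝒪 / 𝓕)ˣ` as a variety over `k`. -/
noncomputable def jacobian : Variety k := specVariety k O.cosetModel.coordRing

/-- The variety `𝓘ₙ` of principal ideals `z 𝒪 ⊆ 𝒪` with `v(z) = n`: writing `z = tⁿ μ`, it is the
closed subvariety of all `[μ] ∈ 𝒥` with `tⁿ μ ∈ 𝒪` (a condition modulo `𝓕`). -/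
noncomputable def principalIdeals (n : Fin d → ℕ) : Variety k :=
  specVariety k (O.cosetModel.coordRing ⧸
    O.cosetModel.condIdeal (Ideal.Quotient.mk O.conductorIdeal (tPow k n)))

open Classical in
/-- `Z(T₁, …, T_d, 𝒪) = ∑_{n ∈ S} [𝓘ₙ] 𝕃 ^ (-‖n‖) Tⁿ`. -/
noncomputable def zeta : MvPowerSeries (Fin d) (MotivicRing k) := fun n =>
  if ⇑n ∈ O.valueSemigroup then
    MotivicRing.mk (O.principalIdeals n) * MotivicRing.lefschetzInv k ^ (∑ i, n i) else 0

/-- `Z(T, 𝒪) = Z(T, …, T, 𝒪)`. -/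
noncomputable def zetaDiag : PowerSeries (MotivicRing k) :=
  MvPowerSeries.subst (fun _ : Fin d => (PowerSeries.X : PowerSeries (MotivicRing k))) O.zeta

end TotallyRationalRing
end CurveZeta

/-! Everything rests on the conductor ideal `𝓕 = t^c 𝒪~`, which lies in `𝒪`. The condition `tⁿ μ ∈
𝒪` is read modulo `𝓕`, and `tⁿ` modulo `𝓕` sees only `n ⊓ c`; whether `n` lies in `S` depends only
on `n ⊓ c` as well. So the class `[𝓘ₙ]`, taken as zero off `S`, is a function of `n ⊓ c`
(`idealClass_inf_conductor`), and there are only finitely many values of `n ⊓ c`.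

Write `l = 𝕃⁻¹` and group the exponents `n` according to `m = n ⊓ c`. The sum of `(l T) ^ ‖n‖` over
one group factors over the coordinates: a coordinate with `mᵢ < cᵢ` contributes the single monomial
`(l T) ^ mᵢ`, one with `mᵢ = cᵢ` the geometric tail `(l T) ^ cᵢ / (1 - l T)`. This is `zetaDiag_eq`,
and `truncGeom_mul` brings every factor to the denominator `1 - l T`, with a numerator of degree at
most `cᵢ`.

At `T = 𝕃` one has `l T = 1`, so a numerator that had to absorb a factor `1 - l T` vanishes
(`eval_truncGeomNum`). Only the group `m = c` survives, with coefficient `[𝓘_c]`; since `t^c` is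
zero modulo `𝓕`, its defining condition is empty and `𝓘_c` is all of `𝒥`. -/

namespace CurveZeta
open CategoryTheory AlgebraicGeometry

/-! ### Classes in the Grothendieck ring and its localization. -/

/-- Isomorphic coordinate rings give the same class in `K₀(Var_k)`. -/
lemma K0.mk_specVariety_congr {k : Type u} [Field k] {R S : Type u} [CommRing R] [Algebra k R]
    [Algebra.FiniteType k R] [CommRing S] [Algebra k S] [Algebra.FiniteType k S] (e : R ≃ₐ[k] S) :
    K0.mk (specVariety k R) = K0.mk (specVariety k S) := by
  -- The difference of the two generators is itself one of the generators of `Ideal.ofRel`. Since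
  -- `Spec` is contravariant, the isomorphism induced by `e` must be reversed.
  refine Ideal.Quotient.eq.2 (Ideal.subset_span ⟨_, _, K0Rel.iso _ _
    (Scheme.Spec.mapIso e.toRingEquiv.toCommRingCatIso.op).symm ?_, sub_add_cancel _ _⟩)
  change Spec.map (CommRingCat.ofHom (e.symm : S →+* R)) ≫
    Spec.map (CommRingCat.ofHom (algebraMap k S)) = Spec.map (CommRingCat.ofHom (algebraMap k R))
  rw [← Spec.map_comp, ← CommRingCat.ofHom_comp]
  congr 2
  ext x
  exact e.symm.commutes x

lemma MotivicRing.lefschetzInv_mul_lefschetz (k : Type u) [Field k] :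
    MotivicRing.lefschetzInv k * MotivicRing.lefschetz k = 1 := by
  rw [mul_comm]
  exact IsLocalization.Away.mul_invSelf (K0.lefschetz k)

/-! ### The coefficients of the zeta function depend only on `n ⊓ c`. -/

namespace TotallyRationalRing
variable {k : Type u} [Field k] {d : ℕ} (O : TotallyRationalRing k d)

/-- Modulo the conductor ideal, `tⁿ` depends only on `min n c`. -/
lemma mk_tPow_inf (n : Fin d → ℕ) :
    Ideal.Quotient.mk O.conductorIdeal (tPow k (n ⊓ O.conductor)) =
      Ideal.Quotient.mk O.conductorIdeal (tPow k n) := by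
  rw [Ideal.Quotient.eq, conductorIdeal, mem_span_tPow]
  intro i
  -- Below the conductor the two exponents coincide; above it both powers are divisible by `X ^ cᵢ`.
  rcases le_total (n i) (O.conductor i) with h | h
  · simp [tPow, h]
  · simpa [tPow, h] using pow_dvd_pow _ h

/-- The exponent enters the definition only through the class of `tⁿ` modulo `𝓕`, so the varieties
are equal and not merely isomorphic. -/
lemma principalIdeals_inf_conductor (n : Fin d → ℕ) :
    O.principalIdeals (n ⊓ O.conductor) = O.principalIdeals n :=
  congrArg (fun τ => specVariety k (O.cosetModel.coordRing ⧸ O.cosetModel.condIdeal τ))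
    (O.mk_tPow_inf n)

/-- Membership in the semigroup of values depends only on `min n c`. -/
lemma inf_conductor_mem_valueSemigroup (n : Fin d → ℕ) :
    n ⊓ O.conductor ∈ O.valueSemigroup ↔ n ∈ O.valueSemigroup := by
  classical
  -- The hypothesis is symmetric in `m` and `m'`, so this one implication yields both directions.
  have key : ∀ m m' : Fin d → ℕ, m ⊓ O.conductor = m' ⊓ O.conductor →
      m ∈ O.valueSemigroup → m' ∈ O.valueSemigroup := by
    rintro m m' h ⟨z, hz, hzo⟩
    -- Where the two exponents differ, truncation must have acted on both, so both have reached the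
    -- conductor.
    have hm : ∀ i, m i ≠ m' i → O.conductor i ≤ m i ∧ O.conductor i ≤ m' i := by
      intro i hi
      have := congrFun h i
      simp only [Pi.inf_apply] at this
      omega
    -- `w` corrects `z` only in coordinates where both orders are at least `cᵢ`, hence by an element
    -- of `𝓕 ⊆ 𝒪`.
    let w : Fin d → PowerSeries k := fun i => if m i = m' i then z i else PowerSeries.X ^ m' i
    refine ⟨w, ?_, fun i => ?_⟩
    · have hw : w - z ∈ O.conductorIdeal := by
        rw [conductorIdeal, mem_span_tPow]
        intro i
        by_cases hi : m i = m' i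
        · simp [w, hi]
        · simp only [Pi.sub_apply, w, if_neg hi]
          refine dvd_sub (pow_dvd_pow _ (hm i hi).2) ((pow_dvd_pow _ (hm i hi).1).trans ?_)
          rw [PowerSeries.X_pow_dvd_iff]
          intro j hj
          exact PowerSeries.coeff_of_lt_order _ (by rw [hzo]; exact_mod_cast hj)
      simpa using O.toSubalgebra.add_mem (O.conductorIdeal_le _ hw) hz
    · by_cases hi : m i = m' i
      · simp [w, hi, hzo]
      · simp [w, hi, PowerSeries.order_X_pow]
  exact ⟨key _ _ (by simp), key _ _ (by simp)⟩

lemma conductor_mem_valueSemigroup : O.conductor ∈ O.valueSemigroup :=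
  O.isLeast_conductor.1 _ le_rfl

/-- The variety `𝓘_c` is all of `𝒥`. -/
lemma mk_principalIdeals_conductor :
    MotivicRing.mk (O.principalIdeals O.conductor) = MotivicRing.mk O.jacobian := by
  have h0 : Ideal.Quotient.mk O.conductorIdeal (tPow k O.conductor) = 0 :=
    Ideal.Quotient.eq_zero_iff_mem.2 (Ideal.mem_span_singleton_self _)
  -- Every generator of the ideal is a linear form evaluated at `0 * μ = 0`.
  have h1 : O.cosetModel.condIdeal
      (Ideal.Quotient.mk O.conductorIdeal (tPow k O.conductor)) = ⊥ := by
    rw [h0, eq_bot_iff, CosetModel.condIdeal, Ideal.span_le]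
    rintro _ ⟨l, -, rfl⟩
    simp
  exact congrArg (algebraMap _ _) (K0.mk_specVariety_congr
    ((Ideal.quotientEquivAlgOfEq k h1).trans (AlgEquiv.quotientBot k _)))

open Classical in
/-- The class `[𝓘ₙ]` for `n ∈ S`, extended by zero. -/
noncomputable def idealClass (n : Fin d → ℕ) : MotivicRing k :=
  if n ∈ O.valueSemigroup then MotivicRing.mk (O.principalIdeals n) else 0

/-- This reduces the infinitely many coefficients to those indexed by the finite box `m ≤ c`. -/
lemma idealClass_inf_conductor (n : Fin d → ℕ) :
    O.idealClass (n ⊓ O.conductor) = O.idealClass n := by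
  classical
  rw [idealClass, idealClass, principalIdeals_inf_conductor]
  exact if_congr (O.inf_conductor_mem_valueSemigroup n) rfl rfl

lemma idealClass_conductor : O.idealClass O.conductor = MotivicRing.mk O.jacobian := by
  rw [idealClass, if_pos O.conductor_mem_valueSemigroup, mk_principalIdeals_conductor]

lemma coeff_zeta (n : Fin d →₀ ℕ) : MvPowerSeries.coeff n O.zeta =
    O.idealClass n * MotivicRing.lefschetzInv k ^ n.degree := by
  rw [Finsupp.degree_eq_sum]
  change O.zeta n = _
  simp only [zeta, idealClass, ite_mul, zero_mul]

end TotallyRationalRing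

/-! ### Restricting a power series to the diagonal. -/

/-- The coefficients of the diagonal `f(T, …, T)` of a power series in several variables. -/
lemma coeff_subst_diag {R : Type*} [CommRing R] {d : ℕ} (f : MvPowerSeries (Fin d) R) (N : ℕ) :
    PowerSeries.coeff N
        (MvPowerSeries.subst (fun _ : Fin d => (PowerSeries.X : PowerSeries R)) f) =
      ∑ n ∈ Finset.univ.finsuppAntidiag N, MvPowerSeries.coeff n f := by
  have hX : MvPowerSeries.HasSubst (fun _ : Fin d => (PowerSeries.X : PowerSeries R)) :=
    MvPowerSeries.hasSubst_of_constantCoeff_zero fun _ => PowerSeries.constantCoeff_X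
  have hterm : ∀ n : Fin d →₀ ℕ,
      (n.prod fun _ e => (PowerSeries.X : PowerSeries R) ^ e) = PowerSeries.X ^ n.degree := by
    intro n
    rw [Finsupp.prod, Finset.prod_pow_eq_pow_sum, Finsupp.degree_apply]
  have hmem : ∀ n : Fin d →₀ ℕ, n ∈ Finset.univ.finsuppAntidiag N ↔ N = n.degree := by
    intro n
    rw [Finset.mem_finsuppAntidiag, Finsupp.degree_eq_sum]
    simp [eq_comm]
  -- Substitution gives a `finsum` over all exponents; as `Tⁿ` becomes `T ^ ‖n‖`, it is supported on
  -- those of total degree `N`.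
  rw [PowerSeries.coeff, MvPowerSeries.coeff_subst hX,
    finsum_eq_sum_of_support_subset (s := Finset.univ.finsuppAntidiag N)]
  · refine Finset.sum_congr rfl fun n hn => ?_
    have h1 : PowerSeries.coeff N (PowerSeries.X ^ n.degree : PowerSeries R) = 1 := by
      rw [PowerSeries.coeff_X_pow, if_pos ((hmem n).1 hn)]
    rw [hterm]
    -- The goal is a scalar multiple `•`, which for `R` acting on itself is multiplication by
    -- definition.
    exact (congrArg _ h1).trans (mul_one _)
  · intro n hn
    by_contra hcon
    refine hn ?_
    have h1 : PowerSeries.coeff N (PowerSeries.X ^ n.degree : PowerSeries R) = 0 := by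
      rw [PowerSeries.coeff_X_pow, if_neg fun h => hcon ((hmem n).2 h)]
    beta_reduce
    rw [hterm]
    exact (congrArg _ h1).trans (mul_zero _)

/-! ### Truncated geometric series in one variable. -/

/-- The sum of all `(l T) ^ n` with `min n c = m`. -/
noncomputable def truncGeom {R : Type*} [CommRing R] (l : R) (c m : ℕ) : PowerSeries R :=
  PowerSeries.mk fun n => if n ⊓ c = m then l ^ n else 0

open Polynomial in
/-- The numerator of `truncGeom l c m` over the denominator `1 - l T`. -/
noncomputable def truncGeomNum {R : Type*} [CommRing R] (l : R) (c m : ℕ) : R[X] :=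
  (C l * X) ^ m * if m < c then 1 - C l * X else 1

section TruncGeom
variable {R : Type*} [CommRing R] (l : R) {c m : ℕ}

/-- If `m < c`, only `n = m` satisfies `n ⊓ c = m`, so the series is a monomial and the factor `1 -
l T` stays in the numerator. If `m = c`, the series is the tail over `n ≥ c`, and multiplication by
`1 - l T` telescopes it to its first term. -/
lemma truncGeom_mul (h : m ≤ c) :
    truncGeom l c m * (1 - PowerSeries.C l * PowerSeries.X) =
      (truncGeomNum l c m : PowerSeries R) := by
  have hpow : (PowerSeries.C l * PowerSeries.X : PowerSeries R) ^ m =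
      PowerSeries.C (l ^ m) * PowerSeries.X ^ m := by rw [mul_pow, map_pow]
  rw [truncGeomNum]
  split_ifs with hmc
  · have : truncGeom l c m = (PowerSeries.C l * PowerSeries.X) ^ m := by
      ext n
      rw [hpow, PowerSeries.coeff_C_mul, PowerSeries.coeff_X_pow, truncGeom, PowerSeries.coeff_mk]
      have : n ⊓ c = m ↔ n = m := by omega
      simp only [this]
      by_cases hn : n = m <;> simp [hn]
    rw [this]
    push_cast
    rfl
  · obtain rfl : m = c := by omega
    rw [mul_one]
    have h2 : ((((Polynomial.C l * Polynomial.X) ^ m : Polynomial R)) : PowerSeries R) =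
        PowerSeries.C (l ^ m) * PowerSeries.X ^ m := by
      rw [← hpow]; push_cast; rfl
    rw [h2]
    ext n
    rw [PowerSeries.coeff_C_mul, PowerSeries.coeff_X_pow, mul_sub, mul_one, map_sub,
      mul_left_comm, PowerSeries.coeff_C_mul]
    -- Multiplication by `T` shifts coefficients, so the constant coefficient is treated apart.
    cases n with
    | zero =>
      rw [PowerSeries.coeff_zero_mul_X, truncGeom, PowerSeries.coeff_mk]
      rcases Nat.eq_zero_or_pos m with rfl | hm
      · simp
      · simp [hm.ne]
    | succ n =>
      rw [PowerSeries.coeff_succ_mul_X, truncGeom, PowerSeries.coeff_mk, PowerSeries.coeff_mk]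
      simp only [inf_eq_right]
      -- Telescoping: before index `m` both terms vanish, at `m` only the unshifted one is present,
      -- and afterwards `l ^ (n + 1)` cancels against `l * l ^ n`.
      rcases lt_trichotomy (n + 1) m with hn | rfl | hn
      · rw [if_neg (by omega), if_neg (by omega), if_neg (by omega)]; simp
      · simp
      · rw [if_pos (by omega), if_pos (by omega), if_neg (by omega), pow_succ]; ring

/-- The extra factor `1 - l T` raises the degree to at most `m + 1`, but it occurs only when `m <
c`. -/
lemma natDegree_truncGeomNum_le (h : m ≤ c) : (truncGeomNum l c m).natDegree ≤ c := by
  have hX : (Polynomial.C l * Polynomial.X).natDegree ≤ 1 :=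
    (Polynomial.natDegree_C_mul_le _ _).trans Polynomial.natDegree_X_le
  have hp : ((Polynomial.C l * Polynomial.X) ^ m).natDegree ≤ m := by
    simpa using Polynomial.natDegree_pow_le_of_le m hX
  rw [truncGeomNum]
  split_ifs with hmc
  · refine (Polynomial.natDegree_mul_le_of_le hp
      (Polynomial.natDegree_sub_le_of_le (Polynomial.natDegree_one.le.trans zero_le_one)
        hX)).trans ?_
    simpa using hmc
  · rw [mul_one]
    exact hp.trans h

/-- The factor `1 - l T`, present exactly when `m < c`, vanishes at the inverse of `l`, while `(l T)
^ m` becomes `1`. -/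
lemma eval_truncGeomNum {x : R} (hx : l * x = 1) (h : m ≤ c) :
    (truncGeomNum l c m).eval x = if m = c then 1 else 0 := by
  rw [truncGeomNum]
  by_cases hmc : m = c
  · simp [hmc, hx]
  · simp [hmc, lt_of_le_of_ne h hmc, hx]

end TruncGeom

/-! ### Rationality, the degree bound and the value at `𝕃`. -/

namespace TotallyRationalRing
variable {k : Type u} [Field k] {d : ℕ} (O : TotallyRationalRing k d)

/-- `Z(T, 𝒪)` as a finite combination of products of (truncated) geometric series. -/
lemma zetaDiag_eq : O.zetaDiag = ∑ m ∈ Fintype.piFinset fun i => Finset.Iic (O.conductor i),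
    PowerSeries.C (O.idealClass m) *
      ∏ i, truncGeom (MotivicRing.lefschetzInv k) (O.conductor i) (m i) := by
  classical
  ext N
  rw [zetaDiag, coeff_subst_diag, map_sum]
  simp_rw [PowerSeries.coeff_C_mul, PowerSeries.coeff_prod, Finset.mul_sum]
  -- With the exponent `n` of total degree `N` fixed first, `m = n ⊓ c` is the only index in the box
  -- whose product of coefficients at `n` can be nonzero.
  rw [Finset.sum_comm]
  refine Finset.sum_congr rfl fun n _ => ?_
  rw [Finset.sum_eq_single (⇑n ⊓ O.conductor)]
  · simp [truncGeom, coeff_zeta, idealClass_inf_conductor, Finsupp.degree_eq_sum,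
      Finset.prod_pow_eq_pow_sum]
  · intro m _ hm
    obtain ⟨i, hi⟩ := Function.ne_iff.1 hm
    rw [Finset.prod_eq_zero (Finset.mem_univ i), mul_zero]
    rw [truncGeom, PowerSeries.coeff_mk, if_neg]
    exact fun h => hi h.symm
  · intro h
    exact absurd (by simp) h

/-- The numerator `R(T, 𝒪)` of `Z(T, 𝒪)`. -/
noncomputable def zetaNum : Polynomial (MotivicRing k) :=
  ∑ m ∈ Fintype.piFinset fun i => Finset.Iic (O.conductor i), Polynomial.C (O.idealClass m) *
    ∏ i, truncGeomNum (MotivicRing.lefschetzInv k) (O.conductor i) (m i)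

/-- The `d` factors of the denominator are distributed one to each coordinate, where `truncGeom_mul`
applies. -/
lemma coe_zetaNum : (O.zetaNum : PowerSeries (MotivicRing k)) = O.zetaDiag *
    (1 - PowerSeries.C (MotivicRing.lefschetzInv k) * PowerSeries.X) ^ d := by
  rw [zetaDiag_eq, Finset.sum_mul, zetaNum, ← Polynomial.coeToPowerSeries.ringHom_apply, map_sum]
  refine Finset.sum_congr rfl fun m hm => ?_
  rw [Fintype.mem_piFinset] at hm
  rw [map_mul, map_prod, mul_assoc]
  simp only [Polynomial.coeToPowerSeries.ringHom_apply, Polynomial.coe_C]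
  congr 1
  rw [← Fin.prod_const, ← Finset.prod_mul_distrib]
  exact Finset.prod_congr rfl fun i _ => (truncGeom_mul _ (Finset.mem_Iic.1 (hm i))).symm

/-- The bounds `cᵢ` for the individual coordinates add up, uniformly in `m`. -/
lemma natDegree_zetaNum_le : O.zetaNum.natDegree ≤ ∑ i, O.conductor i := by
  refine Polynomial.natDegree_sum_le_of_forall_le _ _ fun m hm => ?_
  rw [Fintype.mem_piFinset] at hm
  refine (Polynomial.natDegree_C_mul_le _ _).trans ((Polynomial.natDegree_prod_le _ _).trans ?_)
  exact Finset.sum_le_sum fun i _ => natDegree_truncGeomNum_le _ (Finset.mem_Iic.1 (hm i))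

lemma eval_lefschetz_zetaNum :
    O.zetaNum.eval (MotivicRing.lefschetz k) = MotivicRing.mk O.jacobian := by
  have hl := MotivicRing.lefschetzInv_mul_lefschetz k
  rw [zetaNum, Polynomial.eval_finsetSum, Finset.sum_eq_single O.conductor]
  · rw [Polynomial.eval_mul, Polynomial.eval_C, Polynomial.eval_prod, idealClass_conductor,
      Finset.prod_eq_one, mul_one]
    intro i _
    rw [eval_truncGeomNum _ hl le_rfl, if_pos rfl]
  · intro m hm hne
    rw [Fintype.mem_piFinset] at hm
    -- One coordinate strictly below the conductor is enough to make the whole product vanish at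
    -- `𝕃`.
    obtain ⟨i, hi⟩ := Function.ne_iff.1 hne
    rw [Polynomial.eval_mul, Polynomial.eval_prod, Finset.prod_eq_zero (Finset.mem_univ i),
      mul_zero]
    rw [eval_truncGeomNum _ hl (Finset.mem_Iic.1 (hm i)), if_neg hi]
  · intro h
    exact absurd (by simp) h

end TotallyRationalRing
end CurveZeta

/-- Rationality is stated with the denominator cleared. Nothing is lost: `1 - 𝕃⁻¹ T` has constant
term `1`, hence is invertible as a power series. -/
theorem corollary6 {k : Type*} [Field k] {d : ℕ} (O : CurveZeta.TotallyRationalRing k d) :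
    ∃ R : Polynomial (CurveZeta.MotivicRing k),
      (R : PowerSeries (CurveZeta.MotivicRing k)) = O.zetaDiag *
        (1 - PowerSeries.C (CurveZeta.MotivicRing.lefschetzInv k) * PowerSeries.X) ^ d ∧
      R.natDegree ≤ ∑ i, O.conductor i ∧
      R.eval (CurveZeta.MotivicRing.lefschetz k) = CurveZeta.MotivicRing.mk O.jacobian :=
  ⟨O.zetaNum, O.coe_zetaNum, O.natDegree_zetaNum_le, O.eval_lefschetz_zetaNum⟩
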